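/- Let $\omega^\omega$ be Baire space. A representation of a set $X$ is a surjective partial function $\rho\colon\subseteq\omega^\omega\to X$; a representation of a topological space $X$ is \emph{admissible} if it is continuous on its domain and for every partial continuous $g\colon\subseteq\omega^\omega\to X$ there is a partial continuous $G\colon\subseteq\omega^\omega\to\omega^\omega$ with $g=\rho\circ G$. (Partial functions are continuous if they are continuous on their domains with the subspace topology, and equality of partial functions includes equality of domains.) Let $\langle\xi_n\rangle_{n\in\omega}$ denote the standard encoding of a sequence of elements of $\omega^\omega$ as a single element, $\langle\xi_n\rangle_n(\langle n,m\rangle)=\xi_n(m)$ for the standard pairing of natural numbers, and let $j_\Delta\colon\subseteq\omega^\omega\to\omega^\omega$ be the partial function that is defined at $\langle\xi_n\rangle_n$ if and only if $(\xi_n)_n$ is eventually constant, with value $\lim_n\xi_n$. For spaces $X,Y$ with representations $\rho_X,\rho_Y$, a total function $f\colon X\to Y$ is \emph{$j_\Delta$-realizable} if there is a partial continuous $F\colon\subseteq\omega^\omega\to\omega^\omega$ with $f\circ\rho_X=\rho_Y\circ j_\Delta\circ F$. A subset of $X$ is $\mathbf{\Sigma}^0_2$ if it is of the form $\bigcup_{i\in\omega}B_i\setminus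 B_i'$ with all $B_i,B_i'$ open, and $\mathbf{\Delta}^0_2$ if both it and its complement are $\mathbf{\Sigma}^0_2$; $f$ is \emph{$\mathbf{\Delta}^0_2$-piecewise continuous} if there are $\mathbf{\Delta}^0_2$ sets $A_i\subseteq X$ $(i\in\omega)$ with $X=\bigcup_{i\in\omega}A_i$ and $f|_{A_i}$ continuous for every $i$. \textbf{Theorem.} Let $X$ and $Y$ be countably based $T_0$-spaces with admissible representations $\rho_X$ and $\rho_Y$, and let $f\colon X\to Y$ be a total function. Then $f$ is $j_\Delta$-realizable if and only if $f$ is $\mathbf{\Delta}^0_2$-piecewise continuous. -/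

import Mathlib

open Set Filter Topology

universe u v

/-- Baire space: sequences of naturals with the product of the discrete topologies. -/
abbrev Baire : Type := ℕ → ℕ

/-- Continuity of a partial function: continuity on its domain of definition, which carries the
subspace topology (the domain is an arbitrary subset, not necessarily open). -/
def PartialContinuous {X : Type u} {Y : Type v} [TopologicalSpace X] [TopologicalSpace Y]
    (F : X →. Y) : Prop :=
  Continuous F.asSubtype

/-- A representation of a set `X`: a surjective partial function from Baire space to `X`. -/
structure BaireRepresentation (X : Type u) where
  /-- the underlying partial function -/
  toPFun : Baire →. X
  surjective : ∀ x : X, ∃ p : Baire, x ∈ toPFun p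

/-- A representation `ρ` of a topological space is admissible if it is continuous and every
partial continuous map `g` from Baire space to `X` is of the form `g = ρ ∘ G` for a partial
continuous `G` on Baire space (equality of partial functions, including domains). -/
def BaireRepresentation.Admissible {X : Type u} [TopologicalSpace X] (ρ : BaireRepresentation X) : Prop :=
  PartialContinuous ρ.toPFun ∧
    ∀ g : Baire →. X, PartialContinuous g →
      ∃ G : Baire →. Baire, PartialContinuous G ∧ g = ρ.toPFun.comp G

/-- `F` realizes `f`: `f ∘ ρX = ρY ∘ F` as partial functions. -/
def Realizes {X : Type u} {Y : Type v} (ρX : BaireRepresentation X) (ρY : BaireRepresentation Y)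
    (F : Baire →. Baire) (f : X →. Y) : Prop :=
  f.comp ρX.toPFun = ρY.toPFun.comp F

/-- `f` is `j`-realizable: there is a continuous partial `F` such that `j ∘ F` realizes `f`. -/
def JRealizable {X : Type u} {Y : Type v} (j : Baire →. Baire) (ρX : BaireRepresentation X)
    (ρY : BaireRepresentation Y) (f : X → Y) : Prop :=
  ∃ F : Baire →. Baire, PartialContinuous F ∧ Realizes ρX ρY (j.comp F) (f : X →. Y)

/-- The standard encoding `⟨ξ₀, ξ₁, …⟩` of sequences of elements of Baire space as single elements
of Baire space, `⟨ξ₀, ξ₁, …⟩(⟨n, m⟩) = ξₙ(m)`; it is a bijection whose inverse sends `p` to the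
sequence of its columns. -/
def baireSeqEquiv : (ℕ → Baire) ≃ Baire where
  toFun ξ := fun k => ξ k.unpair.1 k.unpair.2
  invFun p := fun n m => p (Nat.pair n m)
  left_inv ξ := by funext n m; simp
  right_inv p := by funext k; simp

/-- The operator `j_Δ`: it is defined at `⟨ξ₀, ξ₁, …⟩` iff the sequence `ξ₀, ξ₁, …` is eventually
constant, and its value there is the limit of the sequence. -/
noncomputable def jDelta : Baire →. Baire := fun p =>
  { Dom := ∃ n, ∀ m ≥ n, baireSeqEquiv.symm p m = baireSeqEquiv.symm p n
    get := fun _ => limUnder atTop (baireSeqEquiv.symm p) }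

/-- A set is `Σ⁰₂` (in the sense suited to non-metrizable spaces) if it is a countable union of
differences of open sets. -/
def IsSigma02 {X : Type u} [TopologicalSpace X] (A : Set X) : Prop :=
  ∃ B B' : ℕ → Set X, (∀ i, IsOpen (B i)) ∧ (∀ i, IsOpen (B' i)) ∧ A = ⋃ i, B i \ B' i

/-- A set is `Δ⁰₂` if it and its complement are `Σ⁰₂`. -/
def IsDelta02 {X : Type u} [TopologicalSpace X] (A : Set X) : Prop :=
  IsSigma02 A ∧ IsSigma02 Aᶜ

/-- `f` is `Δ⁰₂`-piecewise continuous: `X` is covered by countably many `Δ⁰₂` sets on each of which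
the restriction of `f` is continuous. -/
def Delta02PiecewiseContinuous {X : Type u} {Y : Type v} [TopologicalSpace X] [TopologicalSpace Y]
    (f : X → Y) : Prop :=
  ∃ A : ℕ → Set X, (∀ i, IsDelta02 (A i)) ∧ (⋃ i, A i) = univ ∧ ∀ i, ContinuousOn f (A i)

/-! The operator `jDelta` lets a continuous machine revise its whole output finitely often.

From realizability to pieces: name a point by any enumeration of the basic open sets containing it;
admissibility of `ρX` converts such names continuously into `ρX`-names. The names of `x` form a
nonempty Gδ set, covered by the relatively closed sets "the output has settled by stage `n`". By
Baire category (`IsGδ.exists_cylinder_inter_subset`), for some `n` and some finite word every name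
of `x` extending the word has settled by `n`. For a fixed pair, such points form a difference of
open sets, because the naming map is open, and on it column `n` realizes `f`, so `f` is continuous
there. There are countably many pairs.

From pieces to realizability: split the pieces into differences of open sets and pull these back to
names. On each, `f` has a continuous realizer, which extends to the names in the larger open set
(`exists_continuousOn_extension`). Guessing the least difference consistent with a growing prefix of
the name needs finitely many revisions (`exists_stagewise_selection`). -/

/-! ### Partial continuous maps -/

theorem PFun.mem_comp_iff {X Y Z : Type*} {G : Y →. Z} {F : X →. Y} {p : X} {z : Z} :
    z ∈ G.comp F p ↔ ∃ y ∈ F p, z ∈ G y :=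
  Part.mem_bind_iff

theorem partialContinuous_iff {X : Type u} {Y : Type v} [TopologicalSpace X] [TopologicalSpace Y]
    {F : X →. Y} : PartialContinuous F ↔
      ∀ V, IsOpen V → ∃ U, IsOpen U ∧ ∀ p, ∀ y ∈ F p, (y ∈ V ↔ p ∈ U) := by
  constructor
  · intro h V hV
    obtain ⟨U, hU, hUV⟩ := isOpen_induced_iff.1 (hV.preimage h)
    refine ⟨U, hU, fun p y hy => ?_⟩
    have hp : p ∈ F.Dom := (F.mem_dom p).2 ⟨y, hy⟩
    have hmem : (⟨p, hp⟩ : F.Dom) ∈ Subtype.val ⁻¹' U ↔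
        (⟨p, hp⟩ : F.Dom) ∈ F.asSubtype ⁻¹' V := by rw [hUV]
    rw [mem_preimage, mem_preimage, PFun.asSubtype_eq_of_mem hy hp] at hmem
    exact hmem.symm
  · intro h
    refine continuous_def.2 fun V hV => ?_
    obtain ⟨U, hU, hUV⟩ := h V hV
    refine isOpen_induced_iff.2 ⟨U, hU, ?_⟩
    ext ⟨p, hp⟩
    obtain ⟨y, hy⟩ := (F.mem_dom p).1 hp
    rw [mem_preimage, mem_preimage, PFun.asSubtype_eq_of_mem hy hp]
    exact (hUV p y hy).symm

theorem PartialContinuous.comp {X Y Z : Type*} [TopologicalSpace X] [TopologicalSpace Y]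
    [TopologicalSpace Z] {G : Y →. Z} {F : X →. Y} (hG : PartialContinuous G)
    (hF : PartialContinuous F) : PartialContinuous (G.comp F) := by
  rw [partialContinuous_iff] at *
  intro V hV
  obtain ⟨U, hU, hUV⟩ := hG V hV
  obtain ⟨W, hW, hWU⟩ := hF U hU
  refine ⟨W, hW, fun p z hz => ?_⟩
  rw [PFun.mem_comp_iff] at hz
  obtain ⟨y, hy, hz⟩ := hz
  rw [hUV y z hz, hWU p y hy]

theorem PartialContinuous.continuousOn {X : Type u} {Y : Type v} [TopologicalSpace X]
    [TopologicalSpace Y] {F : X →. Y} (hF : PartialContinuous F) {g : X → Y} {S : Set X}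
    (hg : ∀ p ∈ S, g p ∈ F p) : ContinuousOn g S := by
  refine continuousOn_iff'.2 fun V hV => ?_
  obtain ⟨U, hU, hUV⟩ := partialContinuous_iff.1 hF V hV
  refine ⟨U, hU, ?_⟩
  ext p
  exact and_congr_left fun hp => hUV p _ (hg p hp)

/-- The restriction of a total function to a set is partial continuous as soon as the function is
continuous on that set. -/
theorem ContinuousOn.partialContinuous_res {X : Type u} {Y : Type v} [TopologicalSpace X]
    [TopologicalSpace Y] {g : X → Y} {S : Set X} (hg : ContinuousOn g S) :
    PartialContinuous (PFun.res g S) := by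
  refine partialContinuous_iff.2 fun V hV => ?_
  obtain ⟨U, hU, hUV⟩ := continuousOn_iff'.1 hg V hV
  refine ⟨U, hU, fun p y hy => ?_⟩
  obtain ⟨hp, rfl⟩ := (PFun.mem_res g S p y).1 hy
  have : p ∈ g ⁻¹' V ∩ S ↔ p ∈ U ∩ S := by rw [hUV]
  simpa [hp] using this

theorem mem_jDelta_iff {r t : Baire} :
    t ∈ jDelta r ↔ ∃ n, ∀ m ≥ n, baireSeqEquiv.symm r m = t := by
  have key : ∀ s n, (∀ m ≥ n, baireSeqEquiv.symm r m = s) →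
      limUnder atTop (baireSeqEquiv.symm r) = s := fun s n h =>
    (tendsto_atTop_of_eventually_const h).limUnder_eq
  constructor
  · rintro ⟨⟨n, hn⟩, ht⟩
    refine ⟨n, fun m hm => ?_⟩
    rw [hn m hm, ← key _ n hn]
    exact ht
  · rintro ⟨n, hn⟩
    exact ⟨⟨n, fun m hm => by rw [hn m hm, hn n le_rfl]⟩, key t n hn⟩

/-! ### Extension and category in Baire space -/

section Cylinders

open PiNat

theorem exists_cylinder_subset {U : Set Baire} (hU : IsOpen U) {p : Baire} (hp : p ∈ U) :
    ∃ n, cylinder p n ⊆ U := by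
  obtain ⟨_, ⟨q, n, rfl⟩, hpq, hqU⟩ :=
    (isTopologicalBasis_cylinders fun _ => ℕ).exists_subset_of_mem_open hp hU
  exact ⟨n, by rwa [mem_cylinder_iff_eq.1 hpq]⟩

/-- A continuous map from a relatively closed subset of a subspace of Baire space into Baire space
extends continuously to the subspace. -/
theorem exists_continuousOn_extension {S C W : Set Baire} {g : Baire → Baire} (hW : IsOpen W)
    (hC : C = S \ W) (hg : ContinuousOn g C) :
    ∃ h : Baire → Baire, ContinuousOn h S ∧ EqOn h g C := by
  classical
  -- Prefix lengths of `p` that already determine the `m`-th output on `C`. The extension reads this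
  -- output at the least such length, with default `0` once the cylinder misses `C`.
  set good : Baire → ℕ → Set ℕ := fun p m =>
    {s | ∀ q ∈ C ∩ cylinder p s, ∀ q' ∈ C ∩ cylinder p s, g q m = g q' m} with hgood
  set val : Set Baire → ℕ → ℕ := fun D m => if h : D.Nonempty then g h.some m else 0 with hval
  have hne : ∀ p ∈ S, ∀ m, (good p m).Nonempty := by
    intro p hp m
    by_cases hpW : p ∈ W
    · obtain ⟨s, hs⟩ := exists_cylinder_subset hW hpW
      exact ⟨s, fun q hq => absurd (hs hq.2) (hC ▸ hq.1).2⟩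
    · have hpC : p ∈ C := hC ▸ ⟨hp, hpW⟩
      have hopen : IsOpen {y : Baire | y m = g p m} :=
        (isOpen_discrete ({g p m} : Set ℕ)).preimage (continuous_apply (A := fun _ : ℕ => ℕ) m)
      obtain ⟨U, hU, hUg⟩ := continuousOn_iff'.1 hg _ hopen
      have hpU : p ∈ U ∩ C := hUg ▸ ⟨rfl, hpC⟩
      obtain ⟨s, hs⟩ := exists_cylinder_subset hU hpU.1
      have hmem : ∀ q ∈ C ∩ cylinder p s, g q m = g p m := fun q hq => by
        have : q ∈ U ∩ C := ⟨hs hq.2, hq.1⟩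
        rw [← hUg] at this
        exact this.1
      exact ⟨s, fun q hq q' hq' => (hmem q hq).trans (hmem q' hq').symm⟩
  refine ⟨fun p m => val (C ∩ cylinder p (sInf (good p m))) m, ?_, ?_⟩
  · refine continuousOn_pi.2 fun m p hp => ?_
    -- Whether a length `t` is good depends only on the first `t` entries, so the least good length
    -- is locally constant.
    have hloc : ∀ q ∈ cylinder p (sInf (good p m)), val (C ∩ cylinder q (sInf (good q m))) m =
        val (C ∩ cylinder p (sInf (good p m))) m := by
      intro q hq
      have hcyl : ∀ t ≤ sInf (good p m), cylinder q t = cylinder p t := fun t ht =>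
        mem_cylinder_iff_eq.1 (cylinder_anti p ht hq)
      have hmem : ∀ t ≤ sInf (good p m), (t ∈ good q m ↔ t ∈ good p m) := fun t ht => by
        simp only [hgood, mem_ofPred_eq, hcyl t ht]
      have hq' := (hmem _ le_rfl).2 (Nat.sInf_mem (hne p hp m))
      have heq : sInf (good q m) = sInf (good p m) :=
        le_antisymm (Nat.sInf_le hq')
          (Nat.sInf_le ((hmem _ (Nat.sInf_le hq')).1 (Nat.sInf_mem ⟨_, hq'⟩)))
      rw [heq, hcyl _ le_rfl]
    refine ContinuousAt.continuousWithinAt (ContinuousAt.congr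
      (f := fun _ => val (C ∩ cylinder p (sInf (good p m))) m) continuousAt_const ?_)
    filter_upwards [(isOpen_cylinder _ p (sInf (good p m))).mem_nhds (self_mem_cylinder p _)]
      with q hq using (hloc q hq).symm
  · intro p hp
    funext m
    have hpS : p ∈ S := (hC ▸ hp).1
    have hD : (C ∩ cylinder p (sInf (good p m))).Nonempty := ⟨p, hp, self_mem_cylinder p _⟩
    simp only [hval, dif_pos hD]
    exact Nat.sInf_mem (hne p hpS m) _ hD.some_mem _ ⟨hp, self_mem_cylinder p _⟩

/-- The Baire category theorem for a `Gδ` subset of Baire space covered by closed sets. -/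
theorem IsGδ.exists_cylinder_inter_subset {E : Set Baire} (hE : IsGδ E) (hne : E.Nonempty)
    {K : ℕ → Set Baire} (hK : ∀ n, IsClosed (K n)) (hcov : E ⊆ ⋃ n, K n) :
    ∃ n, ∃ p ∈ E, ∃ s, E ∩ cylinder p s ⊆ K n := by
  -- Category is applied in the Polish space `closure E`, where `E` is a dense Gδ.
  have : PolishSpace (closure E) := isClosed_closure.polishSpace
  have hd : Dense (Subtype.val ⁻¹' E : Set (closure E)) := by
    rw [Subtype.dense_iff]
    rintro x hx
    rwa [Subtype.image_preimage_coe, inter_eq_self_of_subset_right subset_closure]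
  have hI := (hE.preimage continuous_subtype_val).dense_iUnion_interior_of_closed hd
    (fun n => (hK n).preimage (continuous_subtype_val (p := (· ∈ closure E))))
    (by rw [← preimage_iUnion]; exact preimage_mono hcov)
  obtain ⟨x, hxE, hx⟩ := hd.inter_open_nonempty
    (⋃ n, interior (Subtype.val ⁻¹' K n : Set (closure E)))
    (isOpen_iUnion fun _ => isOpen_interior)
    (by
      obtain ⟨p, hp⟩ := hne
      have : Nonempty (closure E) := ⟨⟨p, subset_closure hp⟩⟩
      exact hI.nonempty)
  obtain ⟨n, hn⟩ := mem_iUnion.1 hxE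
  obtain ⟨U, hU, hUn⟩ := isOpen_induced_iff.1
    (isOpen_interior (s := (Subtype.val ⁻¹' K n : Set (closure E))))
  have hxU : x ∈ (Subtype.val ⁻¹' U : Set (closure E)) := by rwa [hUn]
  obtain ⟨s, hs⟩ := exists_cylinder_subset hU hxU
  refine ⟨n, x, hx, s, fun q hq => ?_⟩
  have : (⟨q, subset_closure hq.1⟩ : closure E) ∈ (Subtype.val ⁻¹' U : Set (closure E)) := hs hq.2
  rw [hUn] at this
  exact interior_subset (s := (Subtype.val ⁻¹' K n : Set (closure E))) this

end Cylinders

theorem IsOpen.isDelta02_diff {X : Type u} [TopologicalSpace X] {B B' : Set X} (hB : IsOpen B)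
    (hB' : IsOpen B') : IsDelta02 (B \ B') := by
  -- The complement is `(univ \ B) ∪ (B' \ ∅)`: index `0` gives the first difference, all others the
  -- second.
  refine ⟨⟨fun _ => B, fun _ => B', fun _ => hB, fun _ => hB', (iUnion_const _).symm⟩,
    fun i => if i = 0 then univ else B', fun i => if i = 0 then B else ∅, ?_, ?_, ?_⟩
  · intro i; dsimp only; split_ifs
    exacts [isOpen_univ, hB']
  · intro i; dsimp only; split_ifs
    exacts [hB, isOpen_empty]
  · ext x
    simp only [mem_compl_iff, Set.mem_sdiff, not_and_or, not_not, mem_iUnion]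
    constructor
    · rintro (h | h)
      · exact ⟨0, by simpa using h⟩
      · exact ⟨1, by simpa using h⟩
    · rintro ⟨i, hi, hi'⟩
      by_cases h0 : i = 0
      · simp only [h0, if_true] at hi'
        exact .inl hi'
      · simp only [h0, if_false] at hi
        exact .inr hi

/-! ### Naming points by enumerating their basic neighbourhoods -/

section EnumerationFibers

open PiNat

variable {X : Type u}

/-- The sequences enumerating the indices of the sets of a family that contain a given point. -/
def enumerationFiber (O : ℕ → Set X) (x : X) : Set Baire :=
  {p | ∀ n, n ∈ range p ↔ x ∈ O n}

/-- "The value `n` occurs" is an open condition on a sequence and its negation a closed one, so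
countably many Gδ conditions are intersected. -/
theorem isGδ_enumerationFiber (O : ℕ → Set X) (x : X) : IsGδ (enumerationFiber O x) := by
  have hopen : ∀ n, IsOpen {p : Baire | n ∈ range p} := fun n => by
    have : {p : Baire | n ∈ range p} = ⋃ k, (fun p : Baire => p k) ⁻¹' {n} := by
      ext p; simp
    rw [this]
    exact isOpen_iUnion fun k => (isOpen_discrete _).preimage (continuous_apply k)
  have : enumerationFiber O x = ⋂ n, {p : Baire | n ∈ range p ↔ x ∈ O n} := by
    ext p; simp only [enumerationFiber, mem_ofPred_eq, mem_iInter]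
  rw [this]
  refine IsGδ.iInter fun n => ?_
  by_cases hx : x ∈ O n
  · simpa only [hx, iff_true] using (hopen n).isGδ
  · simp only [hx, iff_false]
    exact IsClosed.isGδ (hopen n).isClosed_compl

/-- A finite prefix commits only to finitely many neighbourhoods, so it extends to a name of any
point in all of them. This makes the naming map open. -/
theorem exists_mem_enumerationFiber_cylinder {O : ℕ → Set X} {p : Baire} {s : ℕ} {x : X}
    (hx : ∀ k < s, x ∈ O (p k)) (hne : ∃ n, x ∈ O n) :
    ∃ q ∈ cylinder p s, q ∈ enumerationFiber O x := by
  classical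
  obtain ⟨n₀, hn₀⟩ := hne
  -- After the prefix, position `n + s` tests the index `n`; `n₀` fills the positions whose test
  -- fails.
  refine ⟨fun k => if k < s then p k else if x ∈ O (k - s) then k - s else n₀, ?_, fun n => ?_⟩
  · intro k hk; simp [hk]
  · constructor
    · rintro ⟨k, rfl⟩
      dsimp only
      split_ifs with h1 h2
      exacts [hx k h1, h2, hn₀]
    · intro hn
      exact ⟨n + s, by simp [hn]⟩

/-- The images of open sets under the enumeration representation are open. -/
theorem isOpen_setOf_inter_enumerationFiber_nonempty [TopologicalSpace X] {O : ℕ → Set X}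
    (hO : ∀ n, IsOpen (O n)) (hcov : ∀ x, ∃ n, x ∈ O n) {W : Set Baire} (hW : IsOpen W) :
    IsOpen {x | (W ∩ enumerationFiber O x).Nonempty} := by
  refine isOpen_iff_mem_nhds.2 ?_
  rintro x ⟨p, hpW, hp⟩
  obtain ⟨s, hs⟩ := exists_cylinder_subset hW hpW
  have hmem : ⋂ k ∈ Finset.range s, O (p k) ∈ 𝓝 x :=
    (Finset.range s).iInter_mem_sets.2 fun k _ =>
      (hO (p k)).mem_nhds ((hp (p k)).1 (mem_range_self k))
  filter_upwards [hmem] with y hy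
  simp only [Finset.mem_range, mem_iInter] at hy
  obtain ⟨q, hq, hqy⟩ := exists_mem_enumerationFiber_cylinder hy (hcov y)
  exact ⟨q, hs hq, hqy⟩

/-- If the sets `O n` form a basis of a `T₀` space, an admissible representation factors the
enumeration representation of the basis through a partial continuous map. -/
theorem BaireRepresentation.Admissible.exists_lift_enumerationFiber [TopologicalSpace X]
    [T0Space X] {ρ : BaireRepresentation X} (hρ : ρ.Admissible) {O : ℕ → Set X}
    (hO : TopologicalSpace.IsTopologicalBasis (range O)) :
    ∃ G : Baire →. Baire, PartialContinuous G ∧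
      ∀ x, ∀ p ∈ enumerationFiber O x, ∃ q ∈ G p, x ∈ ρ.toPFun q := by
  classical
  have huniq : ∀ {x y p}, p ∈ enumerationFiber O x → p ∈ enumerationFiber O y → x = y := by
    intro x y p hx hy
    refine (hO.inseparable_iff.2 ?_).eq
    rintro _ ⟨n, rfl⟩
    exact (hx n).symm.trans (hy n)
  let δ : Baire →. X := fun p => ⟨∃ x, p ∈ enumerationFiber O x, fun h => h.choose⟩
  have hδ : ∀ p x, x ∈ δ p ↔ p ∈ enumerationFiber O x := by
    intro p x
    constructor
    · rintro ⟨h, rfl⟩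
      exact h.choose_spec
    · intro h
      exact ⟨⟨x, h⟩, huniq (Exists.choose_spec (⟨x, h⟩ : ∃ x, p ∈ enumerationFiber O x)) h⟩
  have hcont : PartialContinuous δ := by
    refine partialContinuous_iff.2 fun V hV => ?_
    refine ⟨⋃ (n) (_ : O n ⊆ V), ⋃ k, (fun p : Baire => p k) ⁻¹' {n}, ?_, fun p x hx => ?_⟩
    · exact isOpen_iUnion fun n => isOpen_iUnion fun _ => isOpen_iUnion fun k =>
        (isOpen_discrete _).preimage (continuous_apply k)
    · have hp := (hδ p x).1 hx
      simp only [mem_iUnion, mem_preimage, mem_singleton_iff, exists_prop]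
      constructor
      · intro hxV
        obtain ⟨_, ⟨n, rfl⟩, hxn, hnV⟩ := hO.exists_subset_of_mem_open hxV hV
        exact ⟨n, hnV, (hp n).2 hxn⟩
      · rintro ⟨n, hnV, hn⟩
        exact hnV ((hp n).1 hn)
  obtain ⟨G, hG, hGδ⟩ := hρ.2 δ hcont
  refine ⟨G, hG, fun x p hp => ?_⟩
  have : x ∈ δ p := (hδ p x).2 hp
  rw [hGδ, PFun.mem_comp_iff] at this
  exact this

end EnumerationFibers

theorem exists_enumeration_isTopologicalBasis (X : Type u) [TopologicalSpace X]
    [SecondCountableTopology X] : ∃ O : ℕ → Set X,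
      TopologicalSpace.IsTopologicalBasis (range O) := by
  obtain ⟨b, hb, -, hbasis⟩ := TopologicalSpace.exists_countable_basis X
  -- Adding `∅` makes the basis nonempty, hence the range of a sequence even when `X` is empty.
  have hb' : TopologicalSpace.IsTopologicalBasis (insert ∅ b) := hbasis.insert_empty
  obtain ⟨O, hO⟩ := (hb.insert ∅).exists_eq_range (insert_nonempty _ _)
  exact ⟨O, hO ▸ hb'⟩

theorem isClosed_setOf_column_eventually_eq (n : ℕ) :
    IsClosed {r : Baire | ∀ m ≥ n, baireSeqEquiv.symm r m = baireSeqEquiv.symm r n} := by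
  have hcol : ∀ m, Continuous fun r : Baire => baireSeqEquiv.symm r m := fun m =>
    continuous_pi fun k => continuous_apply (Nat.pair m k)
  simp only [ofPred_forall]
  exact isClosed_iInter fun m => isClosed_iInter fun _ => isClosed_eq (hcol m) (hcol n)

/-! ### Realizable functions are piecewise continuous -/

theorem delta02PiecewiseContinuous_of_jRealizable {X : Type u} {Y : Type v} [TopologicalSpace X]
    [TopologicalSpace Y] [T0Space X] [SecondCountableTopology X] {ρX : BaireRepresentation X}
    {ρY : BaireRepresentation Y} (hρX : ρX.Admissible) (hρY : PartialContinuous ρY.toPFun)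
    {f : X → Y} (hf : JRealizable jDelta ρX ρY f) : Delta02PiecewiseContinuous f := by
  obtain ⟨F, hF, hreal⟩ := hf
  obtain ⟨O, hO⟩ := exists_enumeration_isTopologicalBasis X
  have hOo : ∀ n, IsOpen (O n) := fun n => hO.isOpen (mem_range_self n)
  have hcov : ∀ x, ∃ n, x ∈ O n := fun x => by
    obtain ⟨_, ⟨n, rfl⟩, hx, -⟩ := hO.exists_subset_of_mem_open (mem_univ x) isOpen_univ
    exact ⟨n, hx⟩
  obtain ⟨G, hG, hGO⟩ := hρX.exists_lift_enumerationFiber hO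
  have hH := hF.comp hG
  set H := F.comp G with hHdef
  have hHf : ∀ x, ∀ p ∈ enumerationFiber O x, ∃ r ∈ H p, ∃ n t,
      (∀ m ≥ n, baireSeqEquiv.symm r m = t) ∧ f x ∈ ρY.toPFun t := by
    intro x p hp
    obtain ⟨q, hq, hx⟩ := hGO x p hp
    have hfx : f x ∈ (f : X →. Y).comp ρX.toPFun q := by
      rw [PFun.mem_comp_iff]
      exact ⟨x, hx, by simp⟩
    rw [hreal, PFun.mem_comp_iff] at hfx
    obtain ⟨t, ht, hft⟩ := hfx
    rw [PFun.mem_comp_iff] at ht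
    obtain ⟨r, hr, ht⟩ := ht
    obtain ⟨n, hn⟩ := mem_jDelta_iff.1 ht
    refine ⟨r, ?_, n, t, hn, hft⟩
    rw [hHdef, PFun.mem_comp_iff]
    exact ⟨q, hq, hr⟩
  -- Within the domain of `H`, the open set `W n` marks the names whose output still changes after
  -- stage `n`; elsewhere it is unconstrained.
  choose W hWo hW using fun n => partialContinuous_iff.1 hH _
    (isClosed_setOf_column_eventually_eq n).isOpen_compl
  have hstable : ∀ n x, ∀ p ∈ enumerationFiber O x, p ∉ W n →
      ∃ r ∈ H p, f x ∈ ρY.toPFun (baireSeqEquiv.symm r n) := by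
    intro n x p hp hpW
    obtain ⟨r, hr, k, t, hk, ht⟩ := hHf x p hp
    have hrn := (not_congr (hW n p r hr)).2 hpW
    rw [mem_compl_iff, not_not] at hrn
    refine ⟨r, hr, ?_⟩
    rwa [← hrn (max n k) (le_max_left _ _), hk _ (le_max_right _ _)]
  let T : ℕ × List ℕ → Set Baire := fun c => {p | PiNat.res p c.2.length = c.2}
  have hTo : ∀ c, IsOpen (T c) := by
    intro c
    refine isOpen_iff_mem_nhds.2 fun p hp => ?_
    filter_upwards [(PiNat.isOpen_cylinder _ p c.2.length).mem_nhds (PiNat.self_mem_cylinder p _)]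
      with q hq
    rw [PiNat.cylinder_eq_res] at hq
    exact Eq.trans hq hp
  -- For `c = (n, w)`, a point of `P c \ Q c` has a name extending `w`, and all such names have
  -- settled by stage `n`.
  let P : ℕ × List ℕ → Set X := fun c => {x | (T c ∩ enumerationFiber O x).Nonempty}
  let Q : ℕ × List ℕ → Set X := fun c => {x | ((T c ∩ W c.1) ∩ enumerationFiber O x).Nonempty}
  have hP : ∀ c, IsOpen (P c) := fun c =>
    isOpen_setOf_inter_enumerationFiber_nonempty hOo hcov (hTo c)
  have hQ : ∀ c, IsOpen (Q c) := fun c =>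
    isOpen_setOf_inter_enumerationFiber_nonempty hOo hcov ((hTo c).inter (hWo c.1))
  have hPQcov : ∀ x, ∃ c, x ∈ P c \ Q c := by
    intro x
    obtain ⟨p₀, -, hp₀⟩ := exists_mem_enumerationFiber_cylinder (O := O) (p := 0) (s := 0) (x := x)
      (by simp) (hcov x)
    obtain ⟨n, p, hp, s, hs⟩ := (isGδ_enumerationFiber O x).exists_cylinder_inter_subset
      ⟨p₀, hp₀⟩ (fun n => (hWo n).isClosed_compl) (fun p hp => by
        obtain ⟨r, hr, n, t, hn, -⟩ := hHf x p hp
        refine mem_iUnion.2 ⟨n, fun hpW => (hW n p r hr).2 hpW fun m hm => ?_⟩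
        rw [hn m hm, hn n le_rfl])
    refine ⟨(n, PiNat.res p s), ⟨p, by simp [T], hp⟩, ?_⟩
    rintro ⟨q, ⟨hqT, hqW⟩, hq⟩
    refine hs ⟨hq, ?_⟩ hqW
    rw [PiNat.cylinder_eq_res]
    simpa [T] using hqT
  have hcont : ∀ c, ContinuousOn f (P c \ Q c) := by
    intro c
    refine continuousOn_iff'.2 fun V hV => ?_
    obtain ⟨U, hU, hUV⟩ := partialContinuous_iff.1 hρY V hV
    have hcol : Continuous fun r : Baire => baireSeqEquiv.symm r c.1 :=
      continuous_pi fun k => continuous_apply (Nat.pair c.1 k)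
    obtain ⟨S, hS, hSU⟩ := partialContinuous_iff.1 hH _ (hU.preimage hcol)
    -- All names of `x` in `T c` agree on membership in `S`, so the existence of one in `S`, an open
    -- condition on `x`, decides `f x ∈ V`.
    have hSV : ∀ x, x ∉ Q c → ∀ p ∈ T c ∩ enumerationFiber O x, (f x ∈ V ↔ p ∈ S) := by
      rintro x hx p ⟨hpT, hp⟩
      obtain ⟨r, hr, hfx⟩ := hstable c.1 x p hp fun hpW => hx ⟨p, ⟨hpT, hpW⟩, hp⟩
      rw [hUV _ _ hfx, ← hSU p r hr, mem_preimage]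
    refine ⟨{x | ((T c ∩ S) ∩ enumerationFiber O x).Nonempty},
      isOpen_setOf_inter_enumerationFiber_nonempty hOo hcov ((hTo c).inter hS), ?_⟩
    ext x
    refine and_congr_left fun hx => ?_
    constructor
    · intro hfx
      obtain ⟨p, hpT, hp⟩ := hx.1
      exact ⟨p, ⟨hpT, (hSV x hx.2 p ⟨hpT, hp⟩).1 hfx⟩, hp⟩
    · rintro ⟨p, ⟨hpT, hpS⟩, hp⟩
      exact (hSV x hx.2 p ⟨hpT, hp⟩).2 hpS
  let e := Denumerable.eqv (ℕ × List ℕ)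
  refine ⟨fun i => P (e.symm i) \ Q (e.symm i), fun i => (hP _).isDelta02_diff (hQ _), ?_,
    fun i => hcont _⟩
  refine eq_univ_of_forall fun x => ?_
  obtain ⟨c, hc⟩ := hPQcov x
  exact mem_iUnion.2 ⟨e c, by simpa using hc⟩

/-! ### Piecewise continuous functions are realizable -/

/-- A sequence of maps on Baire space, given near each point of `S` by one of the maps `h i` that is
continuous there, selected by the least index `i` whose guess at stage `n` is consistent with
`p ∈ U i \ V i`. -/
theorem exists_stagewise_selection {S : Set Baire} {U V : ℕ → Set Baire}
    (hU : ∀ i, IsOpen (U i)) (hV : ∀ i, IsOpen (V i)) (hcov : S ⊆ ⋃ i, U i \ V i)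
    {h : ℕ → Baire → Baire} (hh : ∀ i, ContinuousOn (h i) (S ∩ U i)) :
    ∃ F : ℕ → Baire → Baire, (∀ n, ContinuousOn (F n) S) ∧
      ∀ p ∈ S, ∃ i, p ∈ U i \ V i ∧ ∃ n₀, ∀ n ≥ n₀, F n p = h i p := by
  classical
  -- With `D` the length-`n` cylinder of `p`: membership in `U i` is confirmed and membership in `V
  -- i` is not. The bound `i ≤ n` limits stage `n` to finitely many guesses.
  set cand : ℕ → Set Baire → ℕ → Prop := fun n D i => i ≤ n ∧ D ⊆ U i ∧ ¬ D ⊆ V i with hcand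
  set sel : ℕ → Set Baire → Baire → Baire := fun n D =>
    if hD : ∃ i, cand n D i then h (Nat.find hD) else fun _ => 0 with hsel
  refine ⟨fun n p => sel n (PiNat.cylinder p n) p, fun n p hp => ?_, fun p hp => ?_⟩
  · have hev : (fun q => sel n (PiNat.cylinder q n) q) =ᶠ[𝓝[S] p]
        sel n (PiNat.cylinder p n) := by
      filter_upwards [mem_nhdsWithin_of_mem_nhds
        ((PiNat.isOpen_cylinder _ p n).mem_nhds (PiNat.self_mem_cylinder p n))] with q hq
      rw [PiNat.mem_cylinder_iff_eq.1 hq]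
    refine ContinuousWithinAt.congr_of_eventuallyEq ?_ hev rfl
    by_cases hD : ∃ i, cand n (PiNat.cylinder p n) i
    · have hpU : p ∈ U (Nat.find hD) := (Nat.find_spec hD).2.1 (PiNat.self_mem_cylinder p n)
      simp only [hsel, dif_pos hD]
      refine (hh _ p ⟨hp, hpU⟩).mono_of_mem_nhdsWithin ?_
      exact inter_mem self_mem_nhdsWithin
        (mem_nhdsWithin_of_mem_nhds ((hU _).mem_nhds hpU))
    · simp only [hsel, dif_neg hD]
      exact continuousWithinAt_const
  · have hex : ∃ i, p ∈ U i \ V i := mem_iUnion.1 (hcov hp)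
    set i := Nat.find hex with hi
    have hpi : p ∈ U i \ V i := Nat.find_spec hex
    refine ⟨i, hpi, ?_⟩
    -- A smaller index is eventually rejected for good: either `p ∈ V j` gets confirmed, or `p ∉ U
    -- j` and it is never a candidate.
    have hlt : ∀ j, ∃ s, j < i → ∀ n ≥ s, ¬ cand n (PiNat.cylinder p n) j := by
      intro j
      by_cases hj : p ∈ V j
      · obtain ⟨s, hs⟩ := exists_cylinder_subset (hV j) hj
        exact ⟨s, fun _ n hn hc => hc.2.2 ((PiNat.cylinder_anti p hn).trans hs)⟩
      · exact ⟨0, fun hji n _ hc => Nat.find_min hex hji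
          ⟨hc.2.1 (PiNat.self_mem_cylinder p n), hj⟩⟩
    choose s hs using hlt
    obtain ⟨s', hs'⟩ := exists_cylinder_subset (hU i) hpi.1
    refine ⟨max (max i s') ((Finset.range i).sup s), fun n hn => ?_⟩
    have hci : cand n (PiNat.cylinder p n) i :=
      ⟨by omega, (PiNat.cylinder_anti p (by omega)).trans hs',
        fun hc => hpi.2 (hc (PiNat.self_mem_cylinder p n))⟩
    have hD : ∃ i, cand n (PiNat.cylinder p n) i := ⟨i, hci⟩
    have hfind : Nat.find hD = i := (Nat.find_eq_iff hD).2 ⟨hci, fun j hj => hs j hj n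
      ((Finset.le_sup (f := s) (Finset.mem_range.2 hj)).trans (by omega))⟩
    simp only [hsel, dif_pos hD, hfind]

theorem jRealizable_of_delta02PiecewiseContinuous {X : Type u} {Y : Type v} [TopologicalSpace X]
    [TopologicalSpace Y] {ρX : BaireRepresentation X} {ρY : BaireRepresentation Y}
    (hρX : PartialContinuous ρX.toPFun) (hρY : ρY.Admissible) {f : X → Y}
    (hf : Delta02PiecewiseContinuous f) : JRealizable jDelta ρX ρY f := by
  classical
  obtain ⟨A, hA, hAcov, hfA⟩ := hf
  choose B B' hB hB' hAB using fun i => (hA i).1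
  -- The index `i` codes a piece together with one of its differences.
  choose U hU hUB using fun i : ℕ =>
    partialContinuous_iff.1 hρX _ (hB i.unpair.1 i.unpair.2)
  choose V hV hVB using fun i : ℕ =>
    partialContinuous_iff.1 hρX _ (hB' i.unpair.1 i.unpair.2)
  set S := ρX.toPFun.Dom with hS
  have hcov : S ⊆ ⋃ i, U i \ V i := by
    intro p hp
    obtain ⟨x, hx⟩ := (PFun.mem_dom _ _).1 hp
    obtain ⟨i, hi⟩ := mem_iUnion.1 (hAcov ▸ mem_univ x : x ∈ ⋃ i, A i)
    rw [hAB, mem_iUnion] at hi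
    obtain ⟨k, hk, hk'⟩ := hi
    refine mem_iUnion.2 ⟨Nat.pair i k, (hUB _ p x hx).1 ?_, fun hp' => ?_⟩
    · simpa using hk
    · have := (hVB _ p x hx).2 hp'
      simp only [Nat.unpair_pair] at this
      exact hk' this
  have hlocal : ∀ i, ∃ h : Baire → Baire, ContinuousOn h (S ∩ U i) ∧
      ∀ p ∈ U i \ V i, ∀ x ∈ ρX.toPFun p, f x ∈ ρY.toPFun (h p) := by
    intro i
    have hmemA : ∀ p ∈ U i \ V i, ∀ x ∈ ρX.toPFun p, x ∈ A i.unpair.1 := by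
      intro p hp x hx
      rw [hAB, mem_iUnion]
      exact ⟨i.unpair.2, (hUB i p x hx).2 hp.1, fun hxB => hp.2 ((hVB i p x hx).1 hxB)⟩
    have hres : PartialContinuous (PFun.res f (A i.unpair.1)) := (hfA _).partialContinuous_res
    -- Admissibility of `ρY` turns the continuous restriction of `f` into a continuous realizer on
    -- names of points of the piece.
    obtain ⟨G, hG, hGf⟩ := hρY.2 _ (hres.comp hρX)
    have hGex : ∀ p ∈ U i \ V i, ∀ x ∈ ρX.toPFun p, ∃ q ∈ G p, f x ∈ ρY.toPFun q := by
      intro p hp x hx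
      have hfx : f x ∈ (PFun.res f (A i.unpair.1)).comp ρX.toPFun p := by
        rw [PFun.mem_comp_iff]
        exact ⟨x, hx, (PFun.mem_res _ _ _ _).2 ⟨hmemA p hp x hx, rfl⟩⟩
      rwa [hGf, PFun.mem_comp_iff] at hfx
    set g : Baire → Baire := fun p => if hp : ∃ q, q ∈ G p then hp.choose else 0 with hg
    have hgmem : ∀ p q, q ∈ G p → g p ∈ G p := by
      intro p q hq
      have hp : ∃ q, q ∈ G p := ⟨q, hq⟩
      simp only [hg, dif_pos hp]
      exact hp.choose_spec
    have hgG : ∀ p ∈ (S ∩ U i) \ V i, g p ∈ G p := by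
      rintro p ⟨⟨hpS, hpU⟩, hpV⟩
      obtain ⟨x, hx⟩ := (PFun.mem_dom _ _).1 hpS
      obtain ⟨q, hq, -⟩ := hGex p ⟨hpU, hpV⟩ x hx
      exact hgmem p q hq
    -- Removing `V i` leaves a relatively closed subset of `S ∩ U i`. The extension is needed
    -- because a guess can be followed before `V i` is ruled out.
    obtain ⟨h, hh, heq⟩ := exists_continuousOn_extension (hV i) rfl (hG.continuousOn hgG)
    refine ⟨h, hh, fun p hp x hx => ?_⟩
    have hpS : p ∈ S := (PFun.mem_dom _ _).2 ⟨x, hx⟩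
    obtain ⟨q, hq, hfx⟩ := hGex p hp x hx
    rwa [heq ⟨⟨hpS, hp.1⟩, hp.2⟩, Part.mem_unique (hgmem p q hq) hq]
  choose h hh hhf using hlocal
  obtain ⟨F, hF, hFlim⟩ := exists_stagewise_selection hU hV hcov hh
  have hcont : ContinuousOn (fun p => baireSeqEquiv fun n => F n p) S :=
    continuousOn_pi.2 fun k => (continuousOn_pi.1 (hF k.unpair.1)) k.unpair.2
  -- Restricting to the domain of `ρX` makes the domains of the two composites agree.
  refine ⟨PFun.res (fun p => baireSeqEquiv fun n => F n p) S, hcont.partialContinuous_res, ?_⟩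
  have hval : ∀ p ∈ S, ∀ x ∈ ρX.toPFun p, ∃ t, f x ∈ ρY.toPFun t ∧
      t ∈ jDelta (baireSeqEquiv fun n => F n p) := by
    intro p hp x hx
    obtain ⟨i, hpi, n₀, hn₀⟩ := hFlim p hp
    exact ⟨h i p, hhf i p hpi x hx, mem_jDelta_iff.2 ⟨n₀, fun n hn => by simpa using hn₀ n hn⟩⟩
  refine PFun.ext fun p y => ?_
  simp only [PFun.mem_comp_iff, PFun.mem_res, PFun.coe_val, Part.mem_some_iff]
  constructor
  · rintro ⟨x, hx, rfl⟩
    have hp : p ∈ S := (PFun.mem_dom _ _).2 ⟨x, hx⟩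
    obtain ⟨t, hft, ht⟩ := hval p hp x hx
    exact ⟨t, ⟨_, ⟨hp, rfl⟩, ht⟩, hft⟩
  · rintro ⟨t, ⟨_, ⟨hp, rfl⟩, ht⟩, hy⟩
    obtain ⟨x, hx⟩ := (PFun.mem_dom _ _).1 hp
    obtain ⟨t', hft, ht'⟩ := hval p hp x hx
    rw [Part.mem_unique ht ht'] at hy
    exact ⟨x, hx, Part.mem_unique hy hft⟩

theorem theorem17 {X : Type u} {Y : Type v} [TopologicalSpace X] [TopologicalSpace Y]
    [T0Space X] [SecondCountableTopology X] [T0Space Y] [SecondCountableTopology Y]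
    (ρX : BaireRepresentation X) (ρY : BaireRepresentation Y)
    (hρX : ρX.Admissible) (hρY : ρY.Admissible) (f : X → Y) :
    JRealizable jDelta ρX ρY f ↔ Delta02PiecewiseContinuous f :=
  ⟨delta02PiecewiseContinuous_of_jRealizable hρX hρY.1,
    jRealizable_of_delta02PiecewiseContinuous hρX.1 hρY⟩
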